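/- Let $V$ be a finite set. A \emph{directed ancestral graph} $G=(V,D,B)$ has directed edges $D$ and bidirected edges $B$ between distinct vertices, no directed cycle, and no directed path from $i$ to $j$ whenever $i\leftrightarrow j$. Its skeleton $\mathrm{skel}(G)$ is obtained by making all edges undirected, and $|G|:=|D|+|B|$. A path (with distinct vertices) is \emph{m-connecting} given $C\subseteq V$ if every collider on it lies in $C$ or has a directed path to an element of $C$, and no non-endpoint non-collider on it lies in $C$. Vertices $i\neq j$ are m-connected given $C$ if there is an m-connecting path between them given $C$; disjoint sets $A,B$ are m-separated given $C$ (disjoint from $A\cup B$) if no $i\in A$, $j\in B$ are m-connected given $C$. Let $\mathcal I(G)$ be the set of all m-separation relations of $G$; $G$ and $H$ are \emph{Markov equivalent} if $\mathcal I(G)=\mathcal I(H)$. A directed ancestral graph is a \emph{DMAG} if it is maximal, i.e. any two distinct non-adjacent vertices $i,j$ are m-separated given some $S\subseteq V\setminus\{i,j\}$. A path $\langle i,\dots,k,j\rangle$ between non-adjacent $i$ and $j$ is \emph{discriminating} (for $k$) if there is at least one vertex between $i$ and $k$, and each such vertex is a collider on the path and a parent of $j$. Let $\mathbb P$ be the joint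 distribution of random variables $X_i$ ($i\in V$) with values in standard Borel spaces. A DMAG $G$ on $V$ is an \emph{IMAP} of $\mathbb P$ if, for all pairwise disjoint $A,B,C\subseteq V$, m-separation of $A$ and $B$ given $C$ in $G$ implies that $X_A$ and $X_B$ are conditionally independent given $X_C$ under $\mathbb P$. $\mathbb P$ is \emph{adjacency-faithful} to $G$ if for all adjacent $i,j$, $X_i$ and $X_j$ are not conditionally independent given $X_S$ for any $S\subseteq V\setminus\{i,j\}$. $\mathbb P$ is \emph{restricted-faithful} to $G$ if $G$ is an IMAP of $\mathbb P$, $\mathbb P$ is adjacency-faithful to $G$, and, whenever distinct vertices $i,j$ are the end vertices of a path $i-k-j$ in the skeleton of $G$, or of a discriminating path $\langle i,\dots,k,j\rangle$ in $G$, and $i$ and $j$ are m-connected in $G$ given some $S\subseteq V\setminus\{i,j\}$, then $X_i$ and $X_j$ are not conditionally independent given $X_S$. \textbf{Theorem.} Let $G^*$ be a DMAG on $V$ that is an IMAP of $\mathbb P$, and let $G$ be a DMAG that is an IMAP of $\mathbb P$ and satisfies $|G|\le|H|$ for every DMAG $H$ on $V$ that is an IMAP of $\mathbb P$. (a) If $\mathbb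 P$ is adjacency-faithful to $G^*$, then $\mathrm{skel}(G)=\mathrm{skel}(G^*)$. (b) If $\mathbb P$ is restricted-faithful to $G^*$, then $G$ is Markov equivalent to $G^*$. -/

import Mathlib

open MeasureTheory ProbabilityTheory

/-- A directed ancestral graph on `V`: directed edges `dir i j` (`i → j`) and bidirected edges
`bidir.Adj i j` (`i ↔ j`, symmetric and loopless), with no directed cycle, and no directed path
between the endpoints of a bidirected edge.  In particular each pair of vertices carries at most
one edge. -/
structure DirectedAncestralGraph (V : Type*) where
  dir : V → V → Prop
  bidir : SimpleGraph V
  acyclic : ∀ i, ¬ Relation.TransGen dir i i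
  ancestral : ∀ i j, bidir.Adj i j → ¬ Relation.TransGen dir i j

namespace DirectedAncestralGraph

variable {V : Type*} (G : DirectedAncestralGraph V)

/-- The skeleton: all edges replaced by undirected ones. -/
def skel : SimpleGraph V where
  Adj i j := G.dir i j ∨ G.dir j i ∨ G.bidir.Adj i j
  symm := ⟨fun i j h => by
    rcases h with h | h | h
    · exact Or.inr (Or.inl h)
    · exact Or.inl h
    · exact Or.inr (Or.inr h.symm)⟩
  loopless := ⟨fun i h => by
    rcases h with h | h | h
    · exact G.acyclic i (Relation.TransGen.single h)
    · exact G.acyclic i (Relation.TransGen.single h)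
    · exact h.ne rfl⟩

/-- The number of edges `|D| + |B|`. -/
noncomputable def numEdges : ℕ :=
  {e : V × V | G.dir e.1 e.2}.ncard + G.bidir.edgeSet.ncard

/-- The ancestors of a set `C`, which include `C` itself. -/
def an (C : Set V) : Set V :=
  {v | ∃ c ∈ C, Relation.ReflTransGen G.dir v c}

/-- The edge between `a` and `b` has an arrowhead at `b`. -/
def Into (a b : V) : Prop := G.dir a b ∨ G.bidir.Adj a b

/-- `b` is a collider on a path that traverses `a, b, c` consecutively. -/
def IsCollider (a b c : V) : Prop := G.Into a b ∧ G.Into c b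

/-- A path is m-connecting given `C` if every collider on it is an ancestor of `C` and no
(non-endpoint) non-collider on it lies in `C`. -/
def IsMConnecting {i j : V} (p : G.skel.Walk i j) (C : Set V) : Prop :=
  p.IsPath ∧ ∀ a b c, [a, b, c] <:+: p.support →
    (G.IsCollider a b c → b ∈ G.an C) ∧ (¬ G.IsCollider a b c → b ∉ C)

/-- `i` and `j` are m-connected given `C`. -/
def MConn (i j : V) (C : Set V) : Prop :=
  ∃ p : G.skel.Walk i j, G.IsMConnecting p C

/-- `A` and `B` are m-separated given `C`. -/
def MSep (A B C : Set V) : Prop :=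
  ∀ i ∈ A, ∀ j ∈ B, ¬ G.MConn i j C

/-- The set of all m-separation relations of `G` among (pairwise) disjoint sets. -/
def indep : Set (Set V × Set V × Set V) :=
  {t | Disjoint t.1 t.2.1 ∧ Disjoint t.1 t.2.2 ∧ Disjoint t.2.1 t.2.2 ∧
    G.MSep t.1 t.2.1 t.2.2}

/-- Every non-adjacent pair is m-separated by some set. -/
def IsMaximal : Prop :=
  ∀ i j, i ≠ j → ¬ G.skel.Adj i j → ∃ S : Set V, S ⊆ {i, j}ᶜ ∧ G.MSep {i} {j} S

/-- The path `p = ⟨i, …, k, j⟩` is discriminating for `k`: `i` and `j` are non-adjacent, there is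
at least one node between `i` and `k`, and all of those are colliders on `p` and parents of `j`. -/
def IsDiscriminating {i j : V} (p : G.skel.Walk i j) (k : V) : Prop :=
  p.IsPath ∧ ¬ G.skel.Adj i j ∧ p.penultimate = k ∧ 3 ≤ p.length ∧
    ∀ a b c, [a, b, c] <:+: p.support → b ≠ k → G.IsCollider a b c ∧ G.dir b j

end DirectedAncestralGraph

/-- A directed maximal ancestral graph. -/
structure DMAG (V : Type*) extends DirectedAncestralGraph V where
  maximal : toDirectedAncestralGraph.IsMaximal

namespace DMAG

variable {V : Type*}

/-- The graphs Markov equivalent to `G`: those with the same m-separation relations. -/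
def markovClass (G : DMAG V) : Set (DMAG V) := {H | H.indep = G.indep}

end DMAG

section Distribution

variable {V : Type*} [Finite V] {X : V → Type*} [∀ i, MeasurableSpace (X i)]
  [∀ i, StandardBorelSpace (X i)]

/-- `X_A ⊥ X_B ∣ X_C` under the joint distribution `P` of the coordinates. -/
def CondInd (P : Measure (∀ i, X i)) [IsFiniteMeasure P] (A B C : Set V) : Prop :=
  CondIndepFun (MeasurableSpace.comap (C.domRestrict (π := X)) inferInstance)
    (C.measurable_restrict.comap_le) (A.domRestrict (π := X)) (B.domRestrict (π := X)) P

/-- The set of all conditional independence relations of `P` among (pairwise) disjoint sets. -/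
def distIndep (P : Measure (∀ i, X i)) [IsFiniteMeasure P] : Set (Set V × Set V × Set V) :=
  {t | Disjoint t.1 t.2.1 ∧ Disjoint t.1 t.2.2 ∧ Disjoint t.2.1 t.2.2 ∧
    CondInd P t.1 t.2.1 t.2.2}

namespace DMAG

/-- `G` is an independence map of `P`, i.e. `P` is Markov with respect to `G`. -/
def IsIMAP (G : DMAG V) (P : Measure (∀ i, X i)) [IsFiniteMeasure P] : Prop :=
  G.indep ⊆ distIndep P

/-- Adjacent nodes are dependent given every subset of the other nodes. -/
def AdjacencyFaithful (P : Measure (∀ i, X i)) [IsFiniteMeasure P] (G : DMAG V) : Prop :=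
  ∀ i j, G.dir i j ∨ G.bidir.Adj i j → ∀ S : Set V, S ⊆ {i, j}ᶜ → ¬ CondInd P {i} {j} S

/-- The end nodes of a path with two edges are dependent whenever they are m-connected. -/
def OrientationFaithful (P : Measure (∀ i, X i)) [IsFiniteMeasure P] (G : DMAG V) : Prop :=
  ∀ i k j, i ≠ j → G.skel.Adj i k → G.skel.Adj k j →
    ∀ S : Set V, S ⊆ {i, j}ᶜ → G.MConn i j S → ¬ CondInd P {i} {j} S

/-- The end nodes of a discriminating path are dependent whenever they are m-connected. -/
def DiscriminatingFaithful (P : Measure (∀ i, X i)) [IsFiniteMeasure P] (G : DMAG V) : Prop :=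
  ∀ i k j, (∃ p : G.skel.Walk i j, G.IsDiscriminating p k) →
    ∀ S : Set V, S ⊆ {i, j}ᶜ → G.MConn i j S → ¬ CondInd P {i} {j} S

/-- Restricted faithfulness of `P` to `G`. -/
def RestrictedFaithful (P : Measure (∀ i, X i)) [IsFiniteMeasure P] (G : DMAG V) : Prop :=
  G.IsIMAP P ∧ AdjacencyFaithful P G ∧ OrientationFaithful P G ∧ DiscriminatingFaithful P G

end DMAG

end Distribution

/-!
Part (a): a pair adjacent in `Gstar` is dependent given every set, whereas a pair not adjacent in
`G` is separated by some set and hence conditionally independent given it. So the skeleton of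
`Gstar` is contained in that of `G`, and as the number of edges of a graph is the number of edges
of its skeleton, minimality of `G` forces equality.

Part (b): let `i`, `j` be the ends of an unshielded triple or of a path discriminating for `k` in
`G` and in `Gstar`. A set `S` separating them in `G` makes them independent, so by restricted
faithfulness it separates them in `Gstar` too. In either graph `k` is a collider if and only if
`k ∉ S` (`isCollider_iff_notMem`, `isCollider_iff_notMem_of_discriminating`), so the two graphs
agree on unshielded and on discriminated colliders (`SameColliders`). It remains to see that two
maximal graphs which agree in this sense have the same m-connected pairs (`SameColliders.mConn`).

Take an m-connecting path in `G` given `Z` that has as few edges as possible and, among those, the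
least sum of distances from its vertices to `Z` along directed paths; it is m-connecting in the
other graph `H` as well, for the following reasons.

* Statuses (`IsShortest.colliderAt_iff`). If a triple of the path is shielded, then its chord must
  not give a shorter m-connecting path. This forces the middle vertex to be discriminated by a
  segment of the path, to its left or to its right
  (`IsShortest.exists_discriminating_of_dir`). If the segment is discriminating in `H` as well, the
  statuses agree; otherwise the segment contains another vertex whose statuses differ. Among the
  vertices of differing status there are then two consecutive ones whose segments contain each
  other, and this contradicts ancestrality or maximality (`IsMaximal.not_interlocked`).
* Ancestors (`IsTight.mem_an`). Let `b ∉ Z` be a collider on the path and `b → d` the first edge of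
  a shortest directed path to `Z`. If both sides of the path could be redirected to `d`, the
  resulting path would contradict minimality; so on one side `b` is discriminated on a path to `d`,
  which yields `b → d` in `H`. The remaining edges of the directed path belong to unshielded
  non-colliders and keep their orientation one after the other.
-/

namespace DirectedAncestralGraph

variable {V : Type*} {G H : DirectedAncestralGraph V} {Z S : Set V} {a b c d x y : V}
  {v : ℕ → V} {m n k r : ℕ}

/-! ### Orientations of edges -/

lemma Into.adj (h : G.Into a b) : G.skel.Adj a b :=
  h.elim Or.inl fun h => Or.inr (Or.inr h)

lemma adj_of_dir (h : G.dir a b) : G.skel.Adj a b := Or.inl h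

lemma Into.not_transGen (h : G.Into a b) : ¬ Relation.TransGen G.dir b a := fun h' =>
  h.elim (fun h => G.acyclic a (.head h h')) fun h => G.ancestral b a h.symm h'

lemma Into.not_dir (h : G.Into a b) : ¬ G.dir b a := fun h' => h.not_transGen (.single h')

lemma Into.not_dir_dir (h : G.Into a b) (h₁ : G.dir b c) : ¬ G.dir c a := fun h₂ =>
  h.not_transGen (.head h₁ (.single h₂))

lemma dir_of_adj_of_not_into (h : G.skel.Adj a b) (h' : ¬ G.Into a b) : G.dir b a := by
  rcases h with h | h | h
  · exact absurd (Or.inl h) h'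
  · exact h
  · exact absurd (Or.inr h) h'

/-- If `a *→ b → c` and `a`, `c` are adjacent, then `a *→ c`, since otherwise `b` would be an
ancestor of `a`. -/
lemma Into.trans_dir (h : G.Into a b) (h₁ : G.dir b c) (hac : G.skel.Adj a c) : G.Into a c := by
  by_contra h₂
  exact h.not_dir_dir h₁ (dir_of_adj_of_not_into hac h₂)

lemma dir_trans_adj (h : G.dir a b) (h₁ : G.dir b c) (hac : G.skel.Adj a c) : G.dir a c := by
  by_contra h₂
  have hca : G.Into c a := by
    by_contra h₃
    exact h₂ (dir_of_adj_of_not_into hac.symm h₃)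
  exact hca.not_dir_dir h h₁

lemma isCollider_comm : G.IsCollider a b c ↔ G.IsCollider c b a := And.comm

lemma not_isCollider_of_dir (h : G.dir b c) : ¬ G.IsCollider a b c :=
  fun h' => h'.2.not_dir h

lemma not_isCollider_of_dir_left (h : G.dir b a) : ¬ G.IsCollider a b c :=
  fun h' => h'.1.not_dir h

lemma mem_an_of_dir (h : G.dir a b) (hb : b ∈ G.an Z) : a ∈ G.an Z := by
  obtain ⟨z, hz, hbz⟩ := hb
  exact ⟨z, hz, .head h hbz⟩

lemma mem_an_of_mem (h : a ∈ Z) : a ∈ G.an Z := ⟨a, h, .refl⟩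

/-! ### Distance to a set along directed paths -/

/-- `G.ReachIn Z n x`: there is a directed walk of length `n` from `x` to an element of `Z`. -/
def ReachIn (G : DirectedAncestralGraph V) (Z : Set V) : ℕ → V → Prop
  | 0, x => x ∈ Z
  | n + 1, x => ∃ y, G.dir x y ∧ G.ReachIn Z n y

/-- The length of a shortest directed path from `x` to an element of `Z`; the value is `0` when
there is none, that is, when `x ∉ G.an Z`. -/
noncomputable def anDist (G : DirectedAncestralGraph V) (Z : Set V) (x : V) : ℕ :=
  sInf {n | G.ReachIn Z n x}

lemma mem_an_iff_exists_reachIn : x ∈ G.an Z ↔ ∃ n, G.ReachIn Z n x := by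
  constructor
  · rintro ⟨z, hz, h⟩
    induction h using Relation.ReflTransGen.head_induction_on with
    | refl => exact ⟨0, hz⟩
    | head h _ ih => obtain ⟨n, hn⟩ := ih; exact ⟨n + 1, _, h, hn⟩
  · rintro ⟨n, hn⟩
    induction n generalizing x with
    | zero => exact mem_an_of_mem hn
    | succ n ih => obtain ⟨y, hy, hn⟩ := hn; exact mem_an_of_dir hy (ih hn)

lemma reachIn_anDist (h : x ∈ G.an Z) : G.ReachIn Z (G.anDist Z x) x :=
  Nat.sInf_mem (s := {n | G.ReachIn Z n x}) (mem_an_iff_exists_reachIn.1 h)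

lemma anDist_le {n : ℕ} (h : G.ReachIn Z n x) : G.anDist Z x ≤ n := Nat.sInf_le h

lemma anDist_le_succ (h : G.dir x y) (hy : y ∈ G.an Z) : G.anDist Z x ≤ G.anDist Z y + 1 :=
  anDist_le ⟨y, h, reachIn_anDist hy⟩

lemma exists_dir_anDist_succ (hx : x ∈ G.an Z) (hxZ : x ∉ Z) :
    ∃ y, G.dir x y ∧ y ∈ G.an Z ∧ G.anDist Z x = G.anDist Z y + 1 := by
  have h := reachIn_anDist hx
  obtain ⟨n, hn⟩ : ∃ n, G.anDist Z x = n + 1 := by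
    cases h' : G.anDist Z x with
    | zero => rw [h'] at h; exact absurd h hxZ
    | succ n => exact ⟨n, rfl⟩
  rw [hn] at h
  obtain ⟨y, hy, hyn⟩ := h
  have hya : y ∈ G.an Z := mem_an_iff_exists_reachIn.2 ⟨n, hyn⟩
  have h₁ := anDist_le hyn
  have h₂ := anDist_le_succ hy hya
  exact ⟨y, hy, hya, by omega⟩

/-! ### m-connecting sequences -/

/-- A vertex `b` visited between `a` and `c` satisfies the condition of an m-connecting path. -/
def Unblocked (G : DirectedAncestralGraph V) (Z : Set V) (a b c : V) : Prop :=
  (G.IsCollider a b c → b ∈ G.an Z) ∧ (¬ G.IsCollider a b c → b ∉ Z)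

lemma unblocked_comm : G.Unblocked Z a b c ↔ G.Unblocked Z c b a := by
  simp only [Unblocked, isCollider_comm (a := a)]

lemma Unblocked.congr {a' c' : V} (h : G.Unblocked Z a b c)
    (hc : G.IsCollider a' b c' ↔ G.IsCollider a b c) : G.Unblocked Z a' b c' := by
  simpa only [Unblocked, hc] using h

/-- The vertices `v 0, …, v n` are distinct and consecutive ones are adjacent: a path, encoded as
a function on `ℕ` whose values beyond `n` are irrelevant. -/
structure IsPathSeq (G : DirectedAncestralGraph V) (v : ℕ → V) (n : ℕ) : Prop where
  inj : ∀ i ≤ n, ∀ j ≤ n, v i = v j → i = j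
  adj : ∀ i < n, G.skel.Adj (v i) (v (i + 1))

/-- The path `v 0, …, v n` is m-connecting given `Z`. -/
structure IsConnSeq (G : DirectedAncestralGraph V) (Z : Set V) (v : ℕ → V) (n : ℕ) : Prop
    extends IsPathSeq G v n where
  unblocked : ∀ i, i + 2 ≤ n → G.Unblocked Z (v i) (v (i + 1)) (v (i + 2))

lemma IsPathSeq.ne {v : ℕ → V} {n i j : ℕ} (h : G.IsPathSeq v n) (hi : i ≤ n) (hj : j ≤ n)
    (hij : i ≠ j) : v i ≠ v j := fun h' => hij (h.inj i hi j hj h')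

lemma triple_infix_support_iff {S : SimpleGraph V} (p : S.Walk x y) :
    [a, b, c] <:+: p.support ↔ ∃ k, k + 2 ≤ p.length ∧
      p.getVert k = a ∧ p.getVert (k + 1) = b ∧ p.getVert (k + 2) = c := by
  rw [List.infix_iff_getElem?]
  refine exists_congr fun k => ?_
  simp only [List.length_cons, List.length_nil, SimpleGraph.Walk.length_support]
  constructor
  · rintro ⟨hk, h⟩
    have h0 := h 0 (by omega)
    have h1 := h 1 (by omega)
    have h2 := h 2 (by omega)
    rw [← p.getVert_eq_support_getElem? (by omega)] at h0 h1 h2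
    simp only [Option.some.injEq, List.getElem_cons_zero, List.getElem_cons_succ] at h0 h1 h2
    rw [zero_add] at h0
    rw [add_comm] at h1 h2
    exact ⟨by omega, h0, h1, h2⟩
  · rintro ⟨hk, h0, h1, h2⟩
    refine ⟨by omega, fun i hi => ?_⟩
    rw [← p.getVert_eq_support_getElem? (by omega)]
    interval_cases i
    · simpa using h0
    · simpa [add_comm] using h1
    · simpa [add_comm] using h2

lemma isPathSeq_getVert {p : G.skel.Walk x y} (hp : p.IsPath) :
    G.IsPathSeq p.getVert p.length :=
  ⟨fun _ hi _ hj h => hp.getVert_injOn hi hj h, fun _ hi => p.adj_getVert_succ hi⟩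

lemma exists_walk_of_adj {S : SimpleGraph V} (n : ℕ) (v : ℕ → V)
    (h : ∀ i < n, S.Adj (v i) (v (i + 1))) :
    ∃ p : S.Walk (v 0) (v n), p.length = n ∧ ∀ i ≤ n, p.getVert i = v i := by
  induction n generalizing v with
  | zero => exact ⟨.nil, rfl, fun i hi => by simp [Nat.le_zero.1 hi]⟩
  | succ n ih =>
    obtain ⟨p, hp, hpv⟩ := ih (fun i => v (i + 1)) fun i hi => h (i + 1) (by omega)
    refine ⟨.cons (h 0 (by omega)) p, by simp [hp], fun i hi => ?_⟩
    cases i with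
    | zero => simp
    | succ i => simpa using hpv i (by omega)

lemma IsPathSeq.exists_walk {v : ℕ → V} {n : ℕ} (h : G.IsPathSeq v n) (hx : v 0 = x)
    (hy : v n = y) :
    ∃ p : G.skel.Walk x y, p.IsPath ∧ p.length = n ∧ ∀ i ≤ n, p.getVert i = v i := by
  subst hx hy
  obtain ⟨p, hp, hpv⟩ := exists_walk_of_adj n v h.adj
  refine ⟨p, (SimpleGraph.Walk.IsPath.getVert_injOn_iff p).1 fun i hi j hj hij => ?_, hp, hpv⟩
  rw [Set.mem_ofPred_eq, hp] at hi hj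
  rw [hpv i hi, hpv j hj] at hij
  exact h.inj i hi j hj hij

lemma mConn_iff_exists_isConnSeq :
    G.MConn x y Z ↔ ∃ v n, G.IsConnSeq Z v n ∧ v 0 = x ∧ v n = y := by
  constructor
  · rintro ⟨p, hp, h⟩
    exact ⟨p.getVert, p.length, ⟨isPathSeq_getVert hp, fun i hi => h _ _ _
      ((triple_infix_support_iff p).2 ⟨i, hi, rfl, rfl, rfl⟩)⟩, by simp, by simp⟩
  · rintro ⟨v, n, h, rfl, rfl⟩
    obtain ⟨p, hp, hpn, hpv⟩ := h.toIsPathSeq.exists_walk rfl rfl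
    refine ⟨p, hp, fun a b c habc => ?_⟩
    obtain ⟨k, hk, rfl, rfl, rfl⟩ := (triple_infix_support_iff p).1 habc
    rw [hpv k (by omega), hpv (k + 1) (by omega), hpv (k + 2) (by omega)]
    exact h.unblocked k (by omega)

lemma IsPathSeq.mono (h : G.IsPathSeq v n) (hmn : m ≤ n) : G.IsPathSeq v m :=
  ⟨fun i hi j hj => h.inj i (hi.trans hmn) j (hj.trans hmn), fun i hi => h.adj i (by omega)⟩

lemma IsPathSeq.shift (h : G.IsPathSeq v (m + n)) : G.IsPathSeq (fun i => v (m + i)) n :=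
  ⟨fun i hi j hj hij => by have := h.inj _ (by omega) _ (by omega) hij; omega,
    fun i hi => h.adj (m + i) (by omega)⟩

lemma IsPathSeq.reverse (h : G.IsPathSeq v n) : G.IsPathSeq (fun i => v (n - i)) n := by
  refine ⟨fun i hi j hj hij => ?_, fun i hi => ?_⟩
  · have := h.inj _ (by omega) _ (by omega) hij
    omega
  · have := (h.adj (n - (i + 1)) (by omega)).symm
    rwa [show n - (i + 1) + 1 = n - i by omega] at this

lemma IsConnSeq.reverse (h : G.IsConnSeq Z v n) : G.IsConnSeq Z (fun i => v (n - i)) n := by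
  refine ⟨h.toIsPathSeq.reverse, fun i hi => ?_⟩
  have := unblocked_comm.1 (h.unblocked (n - (i + 2)) (by omega))
  rwa [show n - (i + 2) + 1 = n - (i + 1) by omega,
    show n - (i + 2) + 2 = n - i by omega] at this

/-- The initial part `v 0, …, v m` of a path may be left towards `d`: continuing with `d` after
`v m` does not block `v m`. -/
def UnblockedEnd (G : DirectedAncestralGraph V) (Z : Set V) (v : ℕ → V) (m : ℕ) (d : V) : Prop :=
  ∀ i, i + 1 = m → G.Unblocked Z (v i) (v m) d

/-- The final part `v r, …, v n` of a path may be entered from `d`. -/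
def UnblockedStart (G : DirectedAncestralGraph V) (Z : Set V) (v : ℕ → V) (n r : ℕ) (d : V) :
    Prop :=
  r + 1 ≤ n → G.Unblocked Z d (v r) (v (r + 1))

lemma unblockedEnd_reverse_iff {r : ℕ} (hr : r ≤ n) :
    G.UnblockedEnd Z (fun i => v (n - i)) (n - r) d ↔ G.UnblockedStart Z v n r d := by
  constructor
  · intro h hr'
    have := unblocked_comm.1 (h (n - (r + 1)) (by omega))
    simpa only [show n - (n - r) = r by omega, show n - (n - (r + 1)) = r + 1 by omega] using this
  · intro h i hi
    have := unblocked_comm.1 (h (by omega))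
    simp only [show n - (n - r) = r by omega]
    rwa [show n - i = r + 1 by omega]

lemma unblockedStart_reverse_iff (hm : m ≤ n) :
    G.UnblockedStart Z (fun i => v (n - i)) n (n - m) d ↔ G.UnblockedEnd Z v m d := by
  constructor
  · intro h i hi
    have := unblocked_comm.1 (h (by omega))
    simpa only [show n - (n - m) = m by omega, show n - (n - m + 1) = i by omega] using this
  · intro h hm'
    have := unblocked_comm.1 (h (m - 1) (by omega))
    simpa only [show n - (n - m) = m by omega, show n - (n - m + 1) = m - 1 by omega] using this

/-- Replacing the part of an m-connecting path strictly between `v m` and `v (m + 1 + e)` by an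
edge. -/
lemma IsConnSeq.chord {e : ℕ} (h : G.IsConnSeq Z v (n + e)) (hmn : m < n)
    (hadj : G.skel.Adj (v m) (v (m + 1 + e)))
    (hl : G.UnblockedEnd Z v m (v (m + 1 + e)))
    (hr : G.UnblockedStart Z v (n + e) (m + 1 + e) (v m)) :
    G.IsConnSeq Z (fun i => if i ≤ m then v i else v (i + e)) n := by
  refine ⟨⟨fun i hi j hj hij => ?_, fun i hi => ?_⟩, fun i hi => ?_⟩
  · split_ifs at hij with h1 h2 h2 <;> have := h.inj _ (by omega) _ (by omega) hij <;> omega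
  · rcases lt_trichotomy i m with h1 | rfl | h1
    · simpa only [if_pos h1.le, if_pos (show i + 1 ≤ m by omega)] using h.adj i (by omega)
    · simpa using hadj
    · simp only [if_neg (show ¬ i ≤ m by omega), if_neg (show ¬ i + 1 ≤ m by omega)]
      have := h.adj (i + e) (by omega)
      rwa [add_right_comm] at this
  · rcases lt_trichotomy (i + 1) m with h1 | rfl | h1
    · simpa only [if_pos (show i ≤ m by omega), if_pos (show i + 1 ≤ m by omega),
        if_pos (show i + 2 ≤ m by omega)] using h.unblocked i (by omega)
    · simpa using hl i rfl
    · rcases Nat.lt_or_ge m i with h2 | h2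
      · simp only [if_neg (show ¬ i ≤ m by omega), if_neg (show ¬ i + 1 ≤ m by omega),
          if_neg (show ¬ i + 2 ≤ m by omega)]
        have := h.unblocked (i + e) (by omega)
        rwa [add_right_comm i e 1, add_right_comm i e 2] at this
      · obtain rfl : i = m := by omega
        have := hr (by omega)
        simp only [if_pos le_rfl, if_neg (show ¬ i + 1 ≤ i by omega),
          if_neg (show ¬ i + 2 ≤ i by omega)]
        rwa [show i + 1 + e + 1 = i + 2 + e by omega] at this

/-- Replacing the part of an m-connecting path strictly between `v m` and `v (m + 2 + e)` by a
collider `d`. -/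
lemma IsConnSeq.detour {e : ℕ} (h : G.IsConnSeq Z v (n + e)) (hmn : m + 2 ≤ n)
    (hd : d ∈ G.an Z) (hdl : ∀ i ≤ m, v i ≠ d) (hdr : ∀ i, m + 2 + e ≤ i → i ≤ n + e → v i ≠ d)
    (hml : G.Into (v m) d) (hmr : G.Into (v (m + 2 + e)) d)
    (hl : G.UnblockedEnd Z v m d)
    (hr : G.UnblockedStart Z v (n + e) (m + 2 + e) d) :
    G.IsConnSeq Z (fun i => if i ≤ m then v i else if i = m + 1 then d else v (i + e)) n := by
  have u1 : ∀ i ≤ m, (fun i => if i ≤ m then v i else if i = m + 1 then d else v (i + e)) i =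
    v i := fun i hi => if_pos hi
  have u2 : (fun i => if i ≤ m then v i else if i = m + 1 then d else v (i + e)) (m + 1) = d := by
    simp
  have u3 : ∀ i, m + 2 ≤ i → (fun i => if i ≤ m then v i else if i = m + 1 then d else
    v (i + e)) i = v (i + e) := fun i hi => by
      simp only [if_neg (show ¬ i ≤ m by omega), if_neg (show i ≠ m + 1 by omega)]
  generalize (fun i => if i ≤ m then v i else if i = m + 1 then d else v (i + e)) = u at *
  have tri : ∀ i, i ≤ m ∨ i = m + 1 ∨ m + 2 ≤ i := fun i => by omega
  refine ⟨⟨fun i hi j hj hij => ?_, fun i hi => ?_⟩, fun i hi => ?_⟩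
  · rcases tri i with h1 | rfl | h1 <;> rcases tri j with h2 | rfl | h2
    · rw [u1 i h1, u1 j h2] at hij
      exact h.inj _ (by omega) _ (by omega) hij
    · rw [u1 i h1, u2] at hij
      exact absurd hij (hdl i h1)
    · rw [u1 i h1, u3 j h2] at hij
      have := h.inj _ (by omega) _ (by omega) hij
      omega
    · rw [u1 j h2, u2] at hij
      exact absurd hij.symm (hdl j h2)
    · rfl
    · rw [u2, u3 j h2] at hij
      exact absurd hij.symm (hdr _ (by omega) (by omega))
    · rw [u3 i h1, u1 j h2] at hij
      have := h.inj _ (by omega) _ (by omega) hij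
      omega
    · rw [u3 i h1, u2] at hij
      exact absurd hij (hdr _ (by omega) (by omega))
    · rw [u3 i h1, u3 j h2] at hij
      have := h.inj _ (by omega) _ (by omega) hij
      omega
  · rcases tri i with h1 | rfl | h1
    · rcases h1.lt_or_eq with h1 | rfl
      · rw [u1 i h1.le, u1 (i + 1) h1]
        exact h.adj i (by omega)
      · rw [u1 i le_rfl, u2]
        exact hml.adj
    · rw [u2, u3 _ le_rfl]
      exact hmr.adj.symm
    · rw [u3 i h1, u3 (i + 1) (by omega), add_right_comm]
      exact h.adj (i + e) (by omega)
  · rcases tri i with h1 | rfl | h1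
    · rcases lt_trichotomy (i + 1) m with h2 | rfl | h2
      · rw [u1 i h1, u1 (i + 1) h2.le, u1 (i + 2) h2]
        exact h.unblocked i (by omega)
      · rw [u1 i h1, u1 (i + 1) le_rfl, u2]
        exact hl i rfl
      · obtain rfl : i = m := by omega
        rw [u1 i h1, u2, u3 _ le_rfl]
        exact ⟨fun _ => hd, fun h' => absurd ⟨hml, hmr⟩ h'⟩
    · rw [u2, u3 (m + 1 + 1) le_rfl, u3 (m + 1 + 2) (by omega)]
      have := hr (by omega)
      rwa [show m + 2 + e + 1 = m + 1 + 2 + e by omega] at this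
    · rw [u3 i h1, u3 (i + 1) (by omega), u3 (i + 2) (by omega), add_right_comm i 1,
        add_right_comm i 2]
      exact h.unblocked (i + e) (by omega)

/-! ### Shortest m-connecting paths -/

/-- No m-connecting path given `Z` between the same end vertices has fewer edges. -/
structure IsShortest (G : DirectedAncestralGraph V) (Z : Set V) (v : ℕ → V) (n : ℕ) : Prop
    extends IsConnSeq G Z v n where
  min : ∀ u k, G.IsConnSeq Z u k → u 0 = v 0 → u k = v n → n ≤ k

lemma IsShortest.reverse (h : G.IsShortest Z v n) : G.IsShortest Z (fun i => v (n - i)) n :=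
  ⟨h.toIsConnSeq.reverse, fun u k hu h0 hk => h.min _ k hu.reverse (by simpa using hk)
    (by simpa using h0)⟩

/-- A shortest m-connecting path has no shortcut that leaves both ends of the chord unblocked. -/
lemma IsShortest.not_chord (h : G.IsShortest Z v n) (hmr : m + 1 < r) (hr : r ≤ n)
    (hadj : G.skel.Adj (v m) (v r)) (hl : G.UnblockedEnd Z v m (v r))
    (hs : G.UnblockedStart Z v n r (v m)) : False := by
  obtain ⟨e, rfl⟩ : ∃ e, r = m + 1 + e := ⟨r - (m + 1), by omega⟩
  obtain ⟨n, rfl⟩ : ∃ n', n = n' + e := ⟨n - e, by omega⟩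
  have := h.min _ _ (h.toIsConnSeq.chord (by omega) hadj hl hs) (by simp)
    (by simp [show ¬ n ≤ m by omega])
  omega

/-- The vertex `v t` is a collider on the sequence `v`. This is meaningful for `0 < t` only, as
`t - 1` is truncated. -/
def ColliderAt (G : DirectedAncestralGraph V) (v : ℕ → V) (t : ℕ) : Prop :=
  G.IsCollider (v (t - 1)) (v t) (v (t + 1))

lemma colliderAt_reverse_iff {t : ℕ} (h0 : 0 < t) (ht : t < n) :
    G.ColliderAt (fun i => v (n - i)) (n - t) ↔ G.ColliderAt v t := by
  simp only [ColliderAt, show n - (n - t) = t by omega, show n - (n - t - 1) = t + 1 by omega,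
    show n - (n - t + 1) = t - 1 by omega]
  exact isCollider_comm

lemma Unblocked.congr_left {a' : V} (h : G.Unblocked Z a b c)
    (h' : G.Into a b ↔ G.Into a' b) : G.Unblocked Z a' b c :=
  h.congr (by simp only [IsCollider, h'])

lemma Unblocked.congr_right {c' : V} (h : G.Unblocked Z a b c)
    (h' : G.Into c b ↔ G.Into c' b) : G.Unblocked Z a b c' :=
  h.congr (by simp only [IsCollider, h'])

/-- If a path is redirected along an edge out of `b`, then `b` stays unblocked unless it used to
be a collider. -/
lemma Unblocked.of_dir (h : G.Unblocked Z a b c) (hb : G.dir b d) :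
    G.Unblocked Z a b d ∨ G.IsCollider a b c := by
  by_cases hc : G.IsCollider a b c
  · exact Or.inr hc
  · exact Or.inl ⟨fun h' => absurd h' (not_isCollider_of_dir hb), fun _ => h.2 hc⟩

/-- Walking back along an m-connecting path from an edge `v m *→ v (m + 1)` with
`v (m + 1) → d`: either the path can be redirected to `d` with an arrowhead at `d`, or one meets a
vertex not adjacent to `d` such that all vertices in between are colliders and parents of `d`. -/
lemma IsConnSeq.exists_redirect (h : G.IsConnSeq Z v n) (hm : m + 1 ≤ n)
    (hin : G.Into (v m) (v (m + 1))) (hd : G.dir (v (m + 1)) d) :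
    ∃ l ≤ m, (G.Into (v l) d ∧ G.UnblockedEnd Z v l d) ∨
      (¬ G.skel.Adj (v l) d ∧ v l ≠ d ∧
        ∀ t, l < t → t ≤ m → G.ColliderAt v t ∧ G.dir (v t) d) := by
  induction m with
  | zero =>
    refine ⟨0, le_rfl, ?_⟩
    by_cases hadj : G.skel.Adj (v 0) d
    · exact Or.inl ⟨hin.trans_dir hd hadj, fun i hi => absurd hi (by omega)⟩
    · exact Or.inr ⟨hadj, fun h' => hin.not_dir (h' ▸ hd), fun t h1 h2 => by omega⟩
  | succ m ih =>
    by_cases hadj : G.skel.Adj (v (m + 1)) d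
    swap
    · exact ⟨m + 1, le_rfl, Or.inr ⟨hadj, fun h' => hin.not_dir (h' ▸ hd),
        fun t h1 h2 => by omega⟩⟩
    have hind := hin.trans_dir hd hadj
    have hub := h.unblocked m (by omega)
    by_cases hdm : G.Into d (v (m + 1))
    · -- both edges have an arrowhead at `v (m + 1)`, whose status therefore does not change
      have : G.Into (v (m + 2)) (v (m + 1)) := by
        by_contra h'
        exact hdm.not_dir_dir (dir_of_adj_of_not_into hin.adj.symm h') hd
      refine ⟨m + 1, le_rfl, Or.inl ⟨hind, fun i hi => ?_⟩⟩
      obtain rfl : i = m := by omega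
      exact hub.congr_right (iff_of_true this hdm)
    · have hdir := dir_of_adj_of_not_into hadj.symm hdm
      rcases hub.of_dir hdir with hub' | hcol
      · refine ⟨m + 1, le_rfl, Or.inl ⟨hind, fun i hi => ?_⟩⟩
        obtain rfl : i = m := by omega
        exact hub'
      · obtain ⟨l, hl, h'⟩ := ih (by omega) hcol.1 hdir
        refine ⟨l, by omega, h'.imp_right fun ⟨h1, h2, h3⟩ => ⟨h1, h2, fun t ht ht' => ?_⟩⟩
        rcases ht'.lt_or_eq with ht' | rfl
        · exact h3 t ht (by omega)
        · exact ⟨hcol, hdir⟩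

/-- Entering `v (k + 2)` directly from `v k` through an arrowhead never blocks it: if the
status of `v (k + 2)` changes, then `v (k + 1)` is a collider with parent `v (k + 2)`. -/
lemma IsConnSeq.unblockedStart_of_into (h : G.IsConnSeq Z v n) (hk : k + 2 ≤ n)
    (hin : G.Into (v k) (v (k + 2))) : G.UnblockedStart Z v n (k + 2) (v k) := by
  intro hk'
  have hub := h.unblocked (k + 1) (by omega)
  by_cases hbc : G.Into (v (k + 1)) (v (k + 2))
  · exact hub.congr_left (iff_of_true hbc hin)
  · have hcb := dir_of_adj_of_not_into (h.adj (k + 1) (by omega)) hbc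
    have hab : G.Into (v k) (v (k + 1)) := by
      by_contra h'
      exact hin.not_dir_dir hcb (dir_of_adj_of_not_into (h.adj k (by omega)) h')
    exact ⟨fun _ => mem_an_of_dir hcb ((h.unblocked k hk).1 ⟨hab, Or.inl hcb⟩),
      fun _ => hub.2 (not_isCollider_of_dir_left hcb)⟩

lemma IsConnSeq.unblockedEnd_of_into (h : G.IsConnSeq Z v n) (hk : k + 2 ≤ n)
    (hin : G.Into (v (k + 2)) (v k)) : G.UnblockedEnd Z v k (v (k + 2)) := by
  rw [← unblockedStart_reverse_iff (show k ≤ n by omega)]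
  have := h.reverse.unblockedStart_of_into (k := n - (k + 2)) (by omega)
  simp only [show n - (k + 2) + 2 = n - k by omega, show n - (n - k) = k by omega,
    show n - (n - (k + 2)) = k + 2 by omega] at this
  exact this hin

/-- If `v (k + 1)` is shielded by an edge `v k → v (k + 2)` on a shortest m-connecting path,
then some segment `v l, …, v (k + 1), v (k + 2)` of it is a discriminating path for
`v (k + 1)`. -/
lemma IsShortest.exists_discriminating_of_dir (h : G.IsShortest Z v n) (hk : k + 2 ≤ n)
    (hd : G.dir (v k) (v (k + 2))) :
    ∃ l < k, ¬ G.skel.Adj (v l) (v (k + 2)) ∧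
      ∀ t, l < t → t ≤ k → G.ColliderAt v t ∧ G.dir (v t) (v (k + 2)) := by
  -- `v (k + 2)` tolerates the chord, so `v k` does not: it is a collider on the path
  have hstart := h.unblockedStart_of_into hk (Or.inl hd)
  have hend : ¬ G.UnblockedEnd Z v k (v (k + 2)) := fun h' =>
    h.not_chord (by omega) hk (adj_of_dir hd) h' hstart
  obtain ⟨i, hi, hub⟩ : ∃ i, i + 1 = k ∧ ¬ G.Unblocked Z (v i) (v k) (v (k + 2)) := by
    simpa only [UnblockedEnd, not_forall, exists_prop] using hend
  subst hi
  have hcol := (h.unblocked i (by omega)).of_dir hd |>.resolve_left hub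
  have hbc : G.Into (v (i + 2)) (v (i + 3)) := by
    by_contra hbc
    have hcb := dir_of_adj_of_not_into (h.adj (i + 2) (by omega)) hbc
    exact hcol.2.not_dir_dir hd hcb
  obtain ⟨l, hl, ⟨h1, h2⟩ | ⟨h1, -, h2⟩⟩ :=
    h.toIsConnSeq.exists_redirect (by omega) hcol.1 hd
  · refine (h.not_chord (by omega) hk h1.adj h2 fun hk' => ?_).elim
    exact (h.unblocked (i + 2) (by omega)).congr_left (iff_of_true hbc h1)
  · refine ⟨l, by omega, h1, fun t ht ht' => ?_⟩
    rcases ht'.lt_or_eq with ht' | rfl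
    · exact h2 t ht (by omega)
    · exact ⟨hcol, hd⟩

/-- The mirror image of `IsShortest.exists_discriminating_of_dir`. -/
lemma IsShortest.exists_discriminating_of_dir' (h : G.IsShortest Z v n) (hk : k + 2 ≤ n)
    (hd : G.dir (v (k + 2)) (v k)) :
    ∃ r ≤ n, k + 2 < r ∧ ¬ G.skel.Adj (v r) (v k) ∧
      ∀ t, k + 2 ≤ t → t < r → G.ColliderAt v t ∧ G.dir (v t) (v k) := by
  have hd' : G.dir ((fun i => v (n - i)) (n - (k + 2)))
      ((fun i => v (n - i)) (n - (k + 2) + 2)) := by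
    simpa only [show n - (n - (k + 2)) = k + 2 by omega,
      show n - (n - (k + 2) + 2) = k by omega] using hd
  obtain ⟨l, hl, h1, h2⟩ := h.reverse.exists_discriminating_of_dir (by omega) hd'
  simp only [show n - (n - (k + 2) + 2) = k by omega] at h1 h2
  refine ⟨n - l, by omega, by omega, h1, fun t ht ht' => ?_⟩
  have := h2 (n - t) (by omega) (by omega)
  rw [colliderAt_reverse_iff (by omega) (by omega)] at this
  simpa only [show n - (n - t) = t by omega] using this

/-- On a shortest m-connecting path, no two vertices at distance two are joined by a bidirected
edge, so every shielded triple falls under one of the two previous lemmas. -/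
lemma IsShortest.dir_or_dir_of_adj (h : G.IsShortest Z v n) (hk : k + 2 ≤ n)
    (hadj : G.skel.Adj (v k) (v (k + 2))) :
    G.dir (v k) (v (k + 2)) ∨ G.dir (v (k + 2)) (v k) := by
  by_contra! hdir
  have h1 : G.Into (v k) (v (k + 2)) := by
    by_contra h'; exact hdir.2 (dir_of_adj_of_not_into hadj h')
  have h2 : G.Into (v (k + 2)) (v k) := by
    by_contra h'; exact hdir.1 (dir_of_adj_of_not_into hadj.symm h')
  exact h.not_chord (by omega) hk hadj (h.unblockedEnd_of_into hk h2)
    (h.unblockedStart_of_into hk h1)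

/-! ### Graphs with the same unshielded and discriminated colliders -/

/-- `G` and `H` have the same skeleton and the same unshielded colliders, and on every path
`v 0, …, v (k + 1), d` that is discriminating for `v (k + 1)` in both graphs, `v (k + 1)` is a
collider in `G` if and only if it is one in `H`. -/
structure SameColliders (G H : DirectedAncestralGraph V) : Prop where
  skel : G.skel = H.skel
  unshielded : ∀ a b c, G.skel.Adj a b → G.skel.Adj b c → a ≠ c → ¬ G.skel.Adj a c →
    (G.IsCollider a b c ↔ H.IsCollider a b c)
  discriminated : ∀ (v : ℕ → V) (k : ℕ) (d : V), 0 < k → G.IsPathSeq v (k + 1) →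
    (∀ i ≤ k + 1, v i ≠ d) → ¬ G.skel.Adj (v 0) d → G.skel.Adj (v (k + 1)) d →
    (∀ t, 0 < t → t < k + 1 → (G.ColliderAt v t ∧ G.dir (v t) d) ∧
      (H.ColliderAt v t ∧ H.dir (v t) d)) →
    (G.IsCollider (v k) (v (k + 1)) d ↔ H.IsCollider (v k) (v (k + 1)) d)

lemma IsPathSeq.of_skel_eq (hs : G.skel = H.skel) (h : G.IsPathSeq v n) : H.IsPathSeq v n :=
  ⟨h.inj, hs ▸ h.adj⟩

lemma SameColliders.symm (h : SameColliders G H) : SameColliders H G where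
  skel := h.skel.symm
  unshielded a b c := by
    rw [← h.skel]
    exact fun h1 h2 h3 h4 => (h.unshielded a b c h1 h2 h3 h4).symm
  discriminated v k d := by
    rw [← h.skel]
    exact fun h0 hv hd h1 h2 h3 => (h.discriminated v k d h0 (hv.of_skel_eq h.skel.symm) hd h1 h2
      fun t ht ht' => (h3 t ht ht').symm).symm

/-- A discriminating path of `G` whose inner vertices are colliders in `H` too is discriminating
in `H`: the edges into `d` can be oriented one after the other, as each of their tails is
discriminated by the preceding ones. -/
lemma SameColliders.isCollider_iff_of_discriminating_zero (h : SameColliders G H)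
    (hv : G.IsPathSeq v (k + 1)) (hd : ∀ i ≤ k + 1, v i ≠ d) (h0 : ¬ G.skel.Adj (v 0) d)
    (hk : G.skel.Adj (v (k + 1)) d)
    (hc : ∀ t, 0 < t → t < k + 1 → G.ColliderAt v t ∧ H.ColliderAt v t ∧ G.dir (v t) d) :
    G.IsCollider (v k) (v (k + 1)) d ↔ H.IsCollider (v k) (v (k + 1)) d := by
  induction k using Nat.strong_induction_on with
  | _ k ih =>
    have hdir : ∀ t, 0 < t → t < k + 1 → H.dir (v t) d := by
      rintro (_ | t) ht htk
      · omega
      obtain ⟨-, hH, hG⟩ := hc (t + 1) ht htk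
      have := (ih t (by omega) (hv.mono (by omega)) (fun i hi => hd i (by omega)) (adj_of_dir hG)
        fun s hs hst => hc s hs (by omega)).not.1 (not_isCollider_of_dir hG)
      exact dir_of_adj_of_not_into (h.skel ▸ (adj_of_dir hG).symm) fun h' => this ⟨hH.1, h'⟩
    rcases Nat.eq_zero_or_pos k with rfl | hk0
    · exact h.unshielded _ _ _ (hv.adj 0 (by omega)) hk (hd 0 (by omega)) h0
    · exact h.discriminated v k d hk0 hv hd h0 hk fun t ht htk =>
        ⟨⟨(hc t ht htk).1, (hc t ht htk).2.2⟩, (hc t ht htk).2.1, hdir t ht htk⟩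

/-- `SameColliders.isCollider_iff_of_discriminating_zero` for a segment starting at `v m`. -/
lemma SameColliders.isCollider_iff_of_discriminating (h : SameColliders G H)
    (hv : G.IsPathSeq v n) (hmk : m ≤ k) (hkn : k + 1 ≤ n)
    (hd : ∀ i, m ≤ i → i ≤ k + 1 → v i ≠ d) (h0 : ¬ G.skel.Adj (v m) d)
    (hk : G.skel.Adj (v (k + 1)) d)
    (hc : ∀ t, m < t → t ≤ k → G.ColliderAt v t ∧ H.ColliderAt v t ∧ G.dir (v t) d) :
    G.IsCollider (v k) (v (k + 1)) d ↔ H.IsCollider (v k) (v (k + 1)) d := by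
  obtain ⟨k, rfl⟩ := Nat.exists_eq_add_of_le hmk
  refine h.isCollider_iff_of_discriminating_zero (v := fun i => v (m + i)) (k := k)
    (IsPathSeq.shift (hv.mono (by omega))) (fun i hi => hd _ (by omega) (by omega)) h0 hk
    fun t ht htk => ?_
  have := hc (m + t) (by omega) (by omega)
  simpa only [ColliderAt, show m + t - 1 = m + (t - 1) by omega, add_assoc] using this

/-! ### Collider statuses on shortest m-connecting paths -/

lemma mConn_of_unblocked_triple (hab : G.skel.Adj a b) (hbc : G.skel.Adj b c) (hac : a ≠ c)
    (h : G.Unblocked S a b c) : G.MConn a c S := by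
  let u : ℕ → V := fun | 0 => a | 1 => b | _ => c
  refine mConn_iff_exists_isConnSeq.2 ⟨u, 2, ⟨⟨fun i hi j hj hij => ?_, fun i hi => ?_⟩,
    fun i hi => ?_⟩, rfl, rfl⟩
  · have h1 := hab.ne
    have h2 := hbc.ne
    interval_cases i <;> interval_cases j <;>
      first | rfl | exact absurd hij ‹_› | exact absurd hij.symm ‹_›
  · interval_cases i
    · exact hab
    · exact hbc
  · obtain rfl : i = 0 := by omega
    exact h

/-- If `v (k + 1)` is discriminated in `G` by a segment to its left and its statuses in `G` and `H`
differ, then the segment is not discriminating in `H`, so it contains another vertex whose statuses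
differ. -/
lemma SameColliders.exists_discrepancy_left (h : SameColliders G H) (hv : G.IsPathSeq v n)
    (hk : k + 2 ≤ n) (hm : m < k) (h0 : ¬ G.skel.Adj (v m) (v (k + 2)))
    (hc : ∀ t, m < t → t ≤ k → G.ColliderAt v t ∧ G.dir (v t) (v (k + 2)))
    (hbad : ¬ (G.ColliderAt v (k + 1) ↔ H.ColliderAt v (k + 1))) :
    ∃ t, m < t ∧ t ≤ k ∧ ¬ (G.ColliderAt v t ↔ H.ColliderAt v t) := by
  by_contra! hgood
  refine hbad (h.isCollider_iff_of_discriminating hv hm.le (by omega)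
    (fun i hi hik => hv.ne (by omega) hk (by omega)) h0 (hv.adj (k + 1) (by omega))
    fun t ht htk => ⟨(hc t ht htk).1, (hgood t ht htk).1 (hc t ht htk).1, (hc t ht htk).2⟩)

lemma SameColliders.exists_discrepancy_right (h : SameColliders G H) (hv : G.IsPathSeq v n)
    (hr : r ≤ n) (hk : k + 2 < r) (h0 : ¬ G.skel.Adj (v r) (v k))
    (hc : ∀ t, k + 2 ≤ t → t < r → G.ColliderAt v t ∧ G.dir (v t) (v k))
    (hbad : ¬ (G.ColliderAt v (k + 1) ↔ H.ColliderAt v (k + 1))) :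
    ∃ t, k + 2 ≤ t ∧ t < r ∧ ¬ (G.ColliderAt v t ↔ H.ColliderAt v t) := by
  have hk2 : n - (n - (k + 2) + 2) = k := by omega
  obtain ⟨t, ht1, ht2, ht⟩ := h.exists_discrepancy_left (v := fun i => v (n - i)) (m := n - r)
    (k := n - (k + 2)) hv.reverse (by omega) (by omega)
    (by simpa only [hk2, show n - (n - r) = r by omega] using h0)
    (fun t ht htk => by
      have := hc (n - t) (by omega) (by omega)
      rw [← colliderAt_reverse_iff (n := n) (by omega) (by omega)] at this
      simpa only [hk2, show n - (n - t) = t by omega] using this)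
    (by
      rw [show n - (k + 2) + 1 = n - (k + 1) by omega,
        colliderAt_reverse_iff (by omega) (by omega),
        colliderAt_reverse_iff (by omega) (by omega)]
      exact hbad)
  refine ⟨n - t, by omega, by omega, ?_⟩
  rwa [← colliderAt_reverse_iff (n := n) (by omega) (by omega),
    ← colliderAt_reverse_iff (G := H) (n := n) (by omega) (by omega),
    show n - (n - t) = t by omega]

/-- In a maximal graph, two discriminating segments of a path cannot contain each other's
discriminated vertices `v k` and `v j`.  The remaining case is a path of colliders that are all
parents of one of its two non-adjacent ends; a set separating these ends would have to contain
all of the colliders, but then it does not separate them. -/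
lemma IsMaximal.not_interlocked {j : ℕ} (hG : G.IsMaximal) (hv : G.IsPathSeq v n)
    (hmj : m < j) (hjk : j < k) (hkr : k < r) (hr : r ≤ n)
    (h0 : ¬ G.skel.Adj (v m) (v (k + 1)))
    (hl : ∀ t, m < t → t < k → G.ColliderAt v t ∧ G.dir (v t) (v (k + 1)))
    (hs : ∀ t, j < t → t < r → G.ColliderAt v t ∧ G.dir (v t) (v (j - 1))) : False := by
  -- if `v (j - 1)` or `v (k + 1)` is itself inside the other segment, ancestrality is violated
  by_cases h1 : m < j - 1
  · obtain ⟨hc, hd⟩ := hs k hjk hkr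
    exact hc.2.not_dir_dir hd (hl (j - 1) h1 (by omega)).2
  by_cases h2 : k + 1 < r
  · obtain ⟨hc, hd⟩ := hl j hmj hjk
    exact hc.1.not_dir_dir hd (hs (k + 1) (by omega) h2).2
  obtain rfl : r = k + 1 := by omega
  have hjm : j - 1 = m := by omega
  rw [hjm] at hs
  have hmr : v m ≠ v (k + 1) := hv.ne (by omega) hr (by omega)
  obtain ⟨S, -, hS⟩ := hG _ _ hmr h0
  have hsep := hS _ rfl _ rfl
  have hmem : ∀ t, m < t → t < k + 1 → v t ∈ S := by
    intro t ht htk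
    by_contra htS
    have hadj1 : G.skel.Adj (v m) (v t) := by
      by_cases h3 : j < t
      · exact (adj_of_dir (hs t h3 htk).2).symm
      · obtain rfl : t = m + 1 := by omega
        exact hv.adj m (by omega)
    have hadj2 : G.skel.Adj (v t) (v (k + 1)) := by
      by_cases h3 : t < k
      · exact adj_of_dir (hl t ht h3).2
      · obtain rfl : t = k := by omega
        exact hv.adj t (by omega)
    have hnc : ¬ G.IsCollider (v m) (v t) (v (k + 1)) := by
      by_cases h3 : t < k
      · exact not_isCollider_of_dir (hl t ht h3).2
      · exact not_isCollider_of_dir_left (hs t (by omega) htk).2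
    exact hsep (mConn_of_unblocked_triple hadj1 hadj2 hmr ⟨fun h => absurd h hnc, fun _ => htS⟩)
  obtain ⟨e, he⟩ := Nat.exists_eq_add_of_le (show m ≤ k + 1 by omega)
  refine hsep (mConn_iff_exists_isConnSeq.2 ⟨fun i => v (m + i), e,
    ⟨IsPathSeq.shift (hv.mono (by omega)), fun i hi => ?_⟩, rfl, by rw [he]⟩)
  have hcol : G.ColliderAt v (m + i + 1) := by
    by_cases h3 : m + i + 1 < k
    · exact (hl _ (by omega) h3).1
    · exact (hs _ (by omega) (by omega)).1
  exact ⟨fun _ => mem_an_of_mem (hmem _ (by omega) (by omega)), fun h' => absurd hcol h'⟩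

/-- On a shortest m-connecting path in `G`, every vertex has the same collider status in `G` and
in `H`.  A vertex with different statuses is discriminated by a segment, to its left or to its
right, which contains another such vertex.  Hence there are two consecutive ones, the first
discriminated from the right and the second from the left, and their segments are interlocked. -/
lemma IsShortest.colliderAt_iff (h : G.IsShortest Z v n) (hGH : SameColliders G H)
    (hG : G.IsMaximal) {t : ℕ} (ht0 : 0 < t) (htn : t < n) :
    G.ColliderAt v t ↔ H.ColliderAt v t := by
  by_contra hbad
  have hv := h.toIsPathSeq
  let Bad : ℕ → Prop := fun t => 0 < t ∧ t < n ∧ ¬ (G.ColliderAt v t ↔ H.ColliderAt v t)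
  let LeftType : ℕ → Prop := fun k => ∃ m, ¬ G.skel.Adj (v m) (v (k + 1)) ∧
    (∀ t, m < t → t < k → G.ColliderAt v t ∧ G.dir (v t) (v (k + 1))) ∧
    ∃ t, m < t ∧ t < k ∧ Bad t
  let RightType : ℕ → Prop := fun j => ∃ r ≤ n,
    (∀ t, j < t → t < r → G.ColliderAt v t ∧ G.dir (v t) (v (j - 1))) ∧
    ∃ t, j < t ∧ t < r ∧ Bad t
  have htype : ∀ k, Bad k → LeftType k ∨ RightType k := by
    rintro (_ | k) ⟨hk0, hkn, hk⟩
    · omega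
    have hadj : G.skel.Adj (v k) (v (k + 2)) := by
      by_contra hadj
      exact hk (hGH.unshielded _ _ _ (hv.adj k (by omega)) (hv.adj (k + 1) hkn)
        (hv.ne (by omega) (by omega) (by omega)) hadj)
    rcases h.dir_or_dir_of_adj (by omega) hadj with hd | hd
    · obtain ⟨m, hm, h0, hc⟩ := h.exists_discriminating_of_dir (by omega) hd
      obtain ⟨t, h1, h2, h3⟩ := hGH.exists_discrepancy_left hv (by omega) hm h0 hc hk
      exact Or.inl ⟨m, h0, fun t h1 h2 => hc t h1 (by omega), t, h1, by omega, by omega,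
        by omega, h3⟩
    · obtain ⟨r, hr, hkr, h0, hc⟩ := h.exists_discriminating_of_dir' (by omega) hd
      obtain ⟨t, h1, h2, h3⟩ := hGH.exists_discrepancy_right hv hr hkr h0 hc hk
      exact Or.inr ⟨r, hr, fun t h1 h2 => hc t h1 h2, t, h1, h2, by omega, by omega, h3⟩
  have hmax : ∀ (Q : ℕ → Prop), (∀ i, Q i → i ≤ n) → (∃ i, Q i) →
      ∃ i, Q i ∧ ∀ j, Q j → j ≤ i := fun Q hb hQ =>
    ⟨sSup {i | Q i}, Nat.sSup_mem hQ ⟨n, hb⟩, fun j hj => le_csSup ⟨n, hb⟩ hj⟩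
  -- the last vertex with differing statuses is discriminated from the left
  have hleft : ∃ k, Bad k ∧ LeftType k := by
    obtain ⟨k, hk, hk'⟩ := hmax Bad (fun i hi => hi.2.1.le) ⟨t, ht0, htn, hbad⟩
    refine ⟨k, hk, (htype k hk).resolve_right ?_⟩
    rintro ⟨r, -, -, t, h1, -, h2⟩
    exact absurd (hk' t h2) (by omega)
  classical
  -- take the first such vertex `v k`, and the last vertex `v j` before it with differing statuses
  obtain ⟨m, h0, hl, s, hs1, hs2, hs⟩ := (Nat.find_spec hleft).2
  have hfirst : ∀ j, j < Nat.find hleft → Bad j → ¬ LeftType j := fun j hj hb hl =>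
    Nat.find_min hleft hj ⟨hb, hl⟩
  generalize Nat.find hleft = k at *
  obtain ⟨j, ⟨hj, hjk⟩, hj'⟩ := hmax (fun i => Bad i ∧ i < k) (fun i hi => hi.1.2.1.le)
    ⟨s, hs, hs2⟩
  obtain ⟨r, hr, hc, s', hs1', hs2', hs'⟩ := (htype j hj).resolve_left (hfirst j hjk hj)
  have hsj := hj' s ⟨hs, hs2⟩
  have hkr : k ≤ s' := by
    by_contra hlt
    exact absurd (hj' s' ⟨hs', by omega⟩) (by omega)
  exact hG.not_interlocked hv (show m < j by omega) hjk (by omega) hr h0 hl hc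

/-! ### Ancestors of the conditioning set -/

/-- Along a shortest directed path to `Z` all triples are unshielded, so once its first edge has
the same orientation in `H`, all of its edges have. -/
lemma SameColliders.mem_an_of_dir (h : SameColliders G H) (hy : y ∈ G.an Z) (hxy : G.dir x y)
    (hdist : G.anDist Z x = G.anDist Z y + 1) (hxy' : H.dir x y) : y ∈ H.an Z := by
  induction hN : G.anDist Z y generalizing x y with
  | zero =>
    have := reachIn_anDist hy
    rw [hN] at this
    exact mem_an_of_mem this
  | succ N ih =>
    by_cases hyZ : y ∈ Z
    · exact mem_an_of_mem hyZ
    obtain ⟨z, hyz, hz, hyz'⟩ := exists_dir_anDist_succ hy hyZ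
    have hxz : ¬ G.skel.Adj x z := fun hadj => by
      have := anDist_le_succ (dir_trans_adj hxy hyz hadj) hz
      omega
    have hne : x ≠ z := by
      rintro rfl
      exact Into.not_dir (Or.inl hxy) hyz
    have hnc := (h.unshielded x y z (adj_of_dir hxy) (adj_of_dir hyz) hne hxz).not.1
      (not_isCollider_of_dir hyz)
    have hyzH : H.dir y z := dir_of_adj_of_not_into (h.skel ▸ (adj_of_dir hyz).symm)
      fun h' => hnc ⟨Or.inl hxy', h'⟩
    exact DirectedAncestralGraph.mem_an_of_dir hyzH (ih hz hyz hyz' hyzH (by omega))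

/-- A shortest m-connecting path on which, moreover, the sum of the distances from its vertices
to `Z` is as small as possible. -/
structure IsTight (G : DirectedAncestralGraph V) (Z : Set V) (v : ℕ → V) (n : ℕ) : Prop
    extends IsShortest G Z v n where
  sum_le : ∀ u, G.IsConnSeq Z u n → u 0 = v 0 → u n = v n →
    ∑ i ∈ Finset.range (n + 1), G.anDist Z (v i) ≤ ∑ i ∈ Finset.range (n + 1), G.anDist Z (u i)

lemma exists_isTight (h : G.MConn x y Z) : ∃ v n, G.IsTight Z v n ∧ v 0 = x ∧ v n = y := by
  classical
  have h1 : ∃ n v, G.IsConnSeq Z v n ∧ v 0 = x ∧ v n = y := by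
    obtain ⟨v, n, h⟩ := mConn_iff_exists_isConnSeq.1 h
    exact ⟨n, v, h⟩
  have h2 : ∃ s v, (G.IsConnSeq Z v (Nat.find h1) ∧ v 0 = x ∧ v (Nat.find h1) = y) ∧
      ∑ i ∈ Finset.range (Nat.find h1 + 1), G.anDist Z (v i) = s := by
    obtain ⟨v, hv⟩ := Nat.find_spec h1
    exact ⟨_, v, hv, rfl⟩
  obtain ⟨v, ⟨hv, hx, hy⟩, hs⟩ := Nat.find_spec h2
  refine ⟨v, _, ⟨⟨hv, fun u k hu h0 hk => Nat.find_min' h1 ⟨u, hu, h0.trans hx, hk.trans hy⟩⟩,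
    fun u hu h0 hn => ?_⟩, hx, hy⟩
  rw [hs]
  exact Nat.find_min' h2 ⟨u, ⟨hu, h0.trans hx, hn.trans hy⟩, rfl⟩

/-- A vertex `d` into which a final part of a shortest m-connecting path can be redirected does
not occur earlier on the path. -/
lemma IsShortest.ne_of_redirect {t : ℕ} (h : G.IsShortest Z v n) (htr : t + 1 < r) (hr : r ≤ n)
    (hd : d ∈ G.an Z) (hin : G.Into (v r) d) (hs : G.UnblockedStart Z v n r d) : v t ≠ d := by
  rintro rfl
  refine h.not_chord htr hr hin.adj.symm (fun i hi => ⟨fun _ => hd, fun hnc => ?_⟩) hs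
  subst hi
  exact (h.unblocked i (by omega)).2 fun hc => hnc ⟨hc.1, hin⟩

lemma IsShortest.ne_of_redirect' {t : ℕ} (h : G.IsShortest Z v n) (hmt : m + 1 < t) (ht : t ≤ n)
    (hd : d ∈ G.an Z) (hin : G.Into (v m) d) (he : G.UnblockedEnd Z v m d) : v t ≠ d := by
  have := h.reverse.ne_of_redirect (t := n - t) (r := n - m) (d := d) (by omega) (by omega) hd
    (by rwa [show n - (n - m) = m by omega])
    ((unblockedStart_reverse_iff (by omega)).2 he)
  rwa [show n - (n - t) = t by omega] at this

/-- A collider on a tight path cannot be bypassed through a child closer to `Z`. -/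
lemma IsTight.not_detour (h : G.IsTight Z v n) (hmk : m < k) (hkr : k < r) (hr : r ≤ n)
    (hd : d ∈ G.an Z) (hdist : G.anDist Z d < G.anDist Z (v k))
    (hml : G.Into (v m) d) (he : G.UnblockedEnd Z v m d)
    (hmr : G.Into (v r) d) (hs : G.UnblockedStart Z v n r d) : False := by
  have hdl : ∀ i ≤ m, v i ≠ d := fun i hi =>
    h.ne_of_redirect (by omega) hr hd hmr hs
  have hdr : ∀ i, r ≤ i → i ≤ n → v i ≠ d := fun i hi hin =>
    h.ne_of_redirect' (by omega) hin hd hml he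
  obtain ⟨e, rfl⟩ : ∃ e, r = m + 2 + e := ⟨r - (m + 2), by omega⟩
  obtain ⟨n, rfl⟩ : ∃ n', n = n' + e := ⟨n - e, by omega⟩
  have hu := h.detour (by omega) hd hdl hdr hml hmr he hs
  have hlast : (if n ≤ m then v n else if n = m + 1 then d else v (n + e)) = v (n + e) := by
    rw [if_neg (by omega), if_neg (by omega)]
  have := h.min _ _ hu (by simp) hlast
  -- the detour has no more edges than the path, hence equally many, and only `v k` is replaced
  obtain rfl : e = 0 := by omega
  obtain rfl : k = m + 1 := by omega
  refine (h.sum_le _ hu (by simp) hlast).not_gt (Finset.sum_lt_sum (fun i _ => ?_)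
    ⟨m + 1, Finset.mem_range.2 (by omega), by simpa using hdist⟩)
  rcases lt_trichotomy i (m + 1) with hi | rfl | hi
  · rw [if_pos (by omega)]
  · simpa using hdist.le
  · rw [if_neg (by omega), if_neg (by omega)]
    rfl

/-- If `v (m + 1)` is a collider with `v (m + 1) → d`, then either this edge has the same
orientation in `H`, because `v (m + 1)` is discriminated on a path to `d`, or the part of the path
before `v (m + 1)` can be redirected to `d`. -/
lemma IsConnSeq.dir_or_exists_redirect (h : G.IsConnSeq Z v n) (hGH : SameColliders G H)
    (hst : ∀ t, 0 < t → t < n → (G.ColliderAt v t ↔ H.ColliderAt v t)) (hm : m + 1 < n)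
    (hc : G.ColliderAt v (m + 1)) (hd : G.dir (v (m + 1)) d) :
    H.dir (v (m + 1)) d ∨ ∃ l ≤ m, G.Into (v l) d ∧ G.UnblockedEnd Z v l d := by
  obtain ⟨l, hl, h' | ⟨h1, h2, h3⟩⟩ := h.exists_redirect hm.le hc.1 hd
  · exact Or.inr ⟨l, hl, h'⟩
  left
  have hdne : ∀ i, G.dir (v i) d → v i ≠ d := fun i hi => (adj_of_dir hi).ne
  have hnc := (hGH.isCollider_iff_of_discriminating h.toIsPathSeq hl hm.le (d := d)
    (fun i hli him => by
      rcases hli.eq_or_lt with rfl | hli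
      · exact h2
      rcases him.eq_or_lt with rfl | him
      · exact hdne _ hd
      · exact hdne _ (h3 i hli (by omega)).2) h1 (adj_of_dir hd)
    fun t ht htm => ⟨(h3 t ht htm).1, (hst t (by omega) (by omega)).1 (h3 t ht htm).1,
      (h3 t ht htm).2⟩).not.1 (not_isCollider_of_dir hd)
  exact dir_of_adj_of_not_into (hGH.skel ▸ (adj_of_dir hd).symm)
    fun h' => hnc ⟨((hst (m + 1) (by omega) hm).1 hc).1, h'⟩

/-- A collider on a tight path is an ancestor of `Z` in `H` as well. -/
lemma IsTight.mem_an (h : G.IsTight Z v n) (hGH : SameColliders G H) (hG : G.IsMaximal)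
    (hk0 : 0 < k) (hkn : k < n) (hc : G.ColliderAt v k) : v k ∈ H.an Z := by
  obtain ⟨k, rfl⟩ : ∃ k', k = k' + 1 := ⟨k - 1, by omega⟩
  by_cases hkZ : v (k + 1) ∈ Z
  · exact mem_an_of_mem hkZ
  have hst := fun t ht0 htn => h.colliderAt_iff hGH hG (t := t) ht0 htn
  obtain ⟨d, hd, hdan, hdist⟩ := exists_dir_anDist_succ ((h.unblocked k (by omega)).1 hc) hkZ
  suffices H.dir (v (k + 1)) d from
    mem_an_of_dir this (hGH.mem_an_of_dir hdan hd hdist this)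
  rcases h.dir_or_exists_redirect hGH hst hkn hc hd with h' | ⟨l, hl, hl1, hl2⟩
  · exact h'
  -- the same dichotomy on the other side, applied to the reversed path
  have hrk : n - (n - (k + 2) + 1) = k + 1 := by omega
  have hstr : ∀ t, 0 < t → t < n →
      (G.ColliderAt (fun i => v (n - i)) t ↔ H.ColliderAt (fun i => v (n - i)) t) := by
    intro t ht0 htn
    have := hst (n - t) (by omega) (by omega)
    rwa [← colliderAt_reverse_iff (n := n) (by omega) (by omega),
      ← colliderAt_reverse_iff (G := H) (n := n) (by omega) (by omega),
      show n - (n - t) = t by omega] at this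
  rcases h.reverse.dir_or_exists_redirect hGH hstr (m := n - (k + 2)) (d := d) (by omega)
    (by
      rw [← colliderAt_reverse_iff (n := n) (by omega) (by omega)] at hc
      rwa [show n - (k + 2) + 1 = n - (k + 1) by omega])
    (by rwa [hrk]) with h' | ⟨l', hl', hr1, hr2⟩
  · rwa [hrk] at h'
  refine (h.not_detour (show l < k + 1 by omega) (show k + 1 < n - l' by omega) (by omega) hdan
    (by omega) hl1 hl2 hr1 ?_).elim
  rw [← unblockedEnd_reverse_iff (by omega)]
  rwa [show n - (n - l') = l' by omega]

/-- A tight m-connecting path of `G` is m-connecting in `H`. -/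
theorem SameColliders.mConn (hGH : SameColliders G H) (hG : G.IsMaximal) (h : G.MConn x y Z) :
    H.MConn x y Z := by
  obtain ⟨v, n, hv, rfl, rfl⟩ := exists_isTight h
  refine mConn_iff_exists_isConnSeq.2 ⟨v, n, ⟨hv.toIsPathSeq.of_skel_eq hGH.skel,
    fun i hi => ?_⟩, rfl, rfl⟩
  have hst := hv.colliderAt_iff hGH hG (t := i + 1) (by omega) (by omega)
  exact ⟨fun hc => hv.mem_an hGH hG (by omega) (by omega) (hst.2 hc),
    fun hc => (hv.unblocked i hi).2 (hst.not.2 hc)⟩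

theorem SameColliders.indep_eq (hGH : SameColliders G H) (hG : G.IsMaximal) (hH : H.IsMaximal) :
    G.indep = H.indep := by
  have : ∀ x y Z, G.MConn x y Z ↔ H.MConn x y Z := fun x y Z =>
    ⟨hGH.mConn hG, hGH.symm.mConn hH⟩
  simp only [indep, MSep, this]

/-! ### Colliders are determined by separating sets -/

lemma isCollider_iff_notMem (hab : G.skel.Adj a b) (hbc : G.skel.Adj b c) (hac : a ≠ c)
    (hS : ¬ G.MConn a c S) : G.IsCollider a b c ↔ b ∉ S := by
  refine ⟨fun h hb => ?_, fun hb => ?_⟩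
  · exact hS (mConn_of_unblocked_triple hab hbc hac
      ⟨fun _ => mem_an_of_mem hb, fun h' => absurd h h'⟩)
  · by_contra h
    exact hS (mConn_of_unblocked_triple hab hbc hac ⟨fun h' => absurd h' h, fun _ => hb⟩)

/-- The path `v 0, …, v k` extended by `d`. -/
lemma IsPathSeq.append (hv : G.IsPathSeq v k) (hd : ∀ i ≤ k, v i ≠ d)
    (hk : G.skel.Adj (v k) d) : G.IsPathSeq (fun i => if i ≤ k then v i else d) (k + 1) := by
  refine ⟨fun i hi j hj hij => ?_, fun i hi => ?_⟩
  · split_ifs at hij with h1 h2 h2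
    · exact hv.inj i h1 j h2 hij
    · exact absurd hij (hd i h1)
    · exact absurd hij.symm (hd j h2)
    · omega
  · rcases (show i < k ∨ i = k by omega) with h | rfl
    · simpa only [if_pos h.le, if_pos (show i + 1 ≤ k by omega)] using hv.adj i h
    · simpa using hk

/-- On a path discriminating for `v (k + 1)`, a set separating its ends contains `v (k + 1)`
if and only if `v (k + 1)` is not a collider: such a set contains all inner vertices before
`v (k + 1)`, for otherwise the path that leaves for `d` at the first missing one is
m-connecting. -/
lemma isCollider_iff_notMem_of_discriminating (hv : G.IsPathSeq v (k + 1))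
    (hd : ∀ i ≤ k + 1, v i ≠ d) (hk : G.skel.Adj (v (k + 1)) d)
    (hc : ∀ t, 0 < t → t < k + 1 → G.ColliderAt v t ∧ G.dir (v t) d)
    (hS : ¬ G.MConn (v 0) d S) :
    G.IsCollider (v k) (v (k + 1)) d ↔ v (k + 1) ∉ S := by
  have key : ∀ t ≤ k, (∀ s, 0 < s → s < t + 1 → v s ∈ S) → G.skel.Adj (v (t + 1)) d →
      ¬ G.Unblocked S (v t) (v (t + 1)) d := by
    intro t ht hs hadj hub
    refine hS (mConn_iff_exists_isConnSeq.2 ⟨_, t + 2,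
      ⟨(hv.mono (show t + 1 ≤ k + 1 by omega)).append (fun i hi => hd i (by omega)) hadj,
        fun i hi => ?_⟩, by simp, by simp⟩)
    rcases (show i < t ∨ i = t by omega) with hi | rfl
    · simp only [if_pos (show i ≤ t + 1 by omega), if_pos (show i + 1 ≤ t + 1 by omega),
        if_pos (show i + 2 ≤ t + 1 by omega)]
      exact ⟨fun _ => mem_an_of_mem (hs _ (by omega) (by omega)),
        fun h' => absurd (hc (i + 1) (by omega) (by omega)).1 h'⟩
    · simpa using hub
  have hmem : ∀ t, 0 < t → t < k + 1 → v t ∈ S := by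
    intro t
    induction t using Nat.strong_induction_on with
    | _ t ih =>
      intro ht0 htk
      obtain ⟨t, rfl⟩ : ∃ t', t = t' + 1 := ⟨t - 1, by omega⟩
      by_contra htS
      have hdt := (hc (t + 1) ht0 htk).2
      exact key t (by omega) (fun s hs0 hst => ih s hst hs0 (by omega)) (adj_of_dir hdt)
        ⟨fun h' => absurd h' (not_isCollider_of_dir hdt), fun _ => htS⟩
  have := key k le_rfl hmem hk
  refine ⟨fun h hS' => this ⟨fun _ => mem_an_of_mem hS', fun h' => absurd h h'⟩, fun hS' => ?_⟩
  by_contra h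
  exact this ⟨fun h' => absurd h' h, fun _ => hS'⟩

lemma exists_isDiscriminating (hk0 : 0 < k) (hv : G.IsPathSeq v (k + 1))
    (hd : ∀ i ≤ k + 1, v i ≠ d) (h0 : ¬ G.skel.Adj (v 0) d) (hk : G.skel.Adj (v (k + 1)) d)
    (hc : ∀ t, 0 < t → t < k + 1 → G.ColliderAt v t ∧ G.dir (v t) d) :
    ∃ p : G.skel.Walk (v 0) d, G.IsDiscriminating p (v (k + 1)) := by
  obtain ⟨p, hp, hpn, hpv⟩ := (hv.append hd hk).exists_walk (x := v 0) (y := d) (by simp)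
    (by simp)
  have h1 : ∀ i ≤ k + 1, p.getVert i = v i := fun i hi => by
    rw [hpv i (by omega), if_pos hi]
  refine ⟨p, hp, h0, ?_, by omega, ?_⟩
  · rw [SimpleGraph.Walk.penultimate, hpn]
    exact h1 (k + 1) le_rfl
  · intro a b c habc hb
    obtain ⟨i, hi, rfl, rfl, rfl⟩ := (triple_infix_support_iff p).1 habc
    have hik : i + 1 ≠ k + 1 := fun h => hb (by rw [h, h1 _ le_rfl])
    rw [h1 i (by omega), h1 (i + 1) (by omega), h1 (i + 2) (by omega)]
    exact hc (i + 1) (by omega) (by omega)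

/-- If `G` and `H` have the same skeleton, and every set separating in `G` the ends of an
unshielded triple, or of a discriminating path of `H`, separates them in `H` too, then `G` and `H`
have the same unshielded and discriminated colliders. -/
lemma sameColliders_of_separation (hskel : G.skel = H.skel) (hG : G.IsMaximal)
    (htri : ∀ i k j, i ≠ j → H.skel.Adj i k → H.skel.Adj k j → ∀ S : Set V, S ⊆ {i, j}ᶜ →
      ¬ G.MConn i j S → ¬ H.MConn i j S)
    (hdisc : ∀ i k j, (∃ p : H.skel.Walk i j, H.IsDiscriminating p k) →
      ∀ S : Set V, S ⊆ {i, j}ᶜ → ¬ G.MConn i j S → ¬ H.MConn i j S) :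
    SameColliders G H where
  skel := hskel
  unshielded a b c hab hbc hac h := by
    obtain ⟨S, hSsub, hS⟩ := hG a c hac h
    have hS := hS _ rfl _ rfl
    rw [isCollider_iff_notMem hab hbc hac hS, isCollider_iff_notMem (hskel ▸ hab) (hskel ▸ hbc) hac
      (htri a b c hac (hskel ▸ hab) (hskel ▸ hbc) S hSsub hS)]
  discriminated v k d hk0 hv hd h0 hk hc := by
    obtain ⟨S, hSsub, hS⟩ := hG (v 0) d (hd 0 (by omega)) h0
    have hS := hS _ rfl _ rfl
    have hv' := hv.of_skel_eq hskel
    rw [isCollider_iff_notMem_of_discriminating hv hd hk (fun t h1 h2 => (hc t h1 h2).1) hS,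
      isCollider_iff_notMem_of_discriminating hv' hd (hskel ▸ hk)
        (fun t h1 h2 => (hc t h1 h2).2)
        (hdisc _ _ _ (exists_isDiscriminating hk0 hv' hd (hskel ▸ h0) (hskel ▸ hk)
          fun t h1 h2 => (hc t h1 h2).2) S hSsub hS)]

/-! ### Counting edges -/

lemma numEdges_eq_ncard_edgeSet_skel [Finite V] (G : DirectedAncestralGraph V) :
    G.numEdges = G.skel.edgeSet.ncard := by
  have hinj : Set.InjOn (fun e : V × V => s(e.1, e.2)) {e | G.dir e.1 e.2} := by
    rintro ⟨a, b⟩ hab ⟨c, d⟩ hcd h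
    rcases Sym2.eq_iff.1 h with ⟨rfl, rfl⟩ | ⟨rfl, rfl⟩
    · rfl
    · exact absurd hcd (Into.not_dir (Or.inl hab))
  have hunion : G.skel.edgeSet =
      (fun e : V × V => s(e.1, e.2)) '' {e | G.dir e.1 e.2} ∪ G.bidir.edgeSet := by
    ext e
    induction e using Sym2.ind with
    | _ a b =>
      simp only [SimpleGraph.mem_edgeSet, Set.mem_union, Set.mem_image, Prod.exists]
      constructor
      · rintro (h | h | h)
        · exact Or.inl ⟨a, b, h, rfl⟩
        · exact Or.inl ⟨b, a, h, Sym2.eq_swap⟩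
        · exact Or.inr h
      · rintro (⟨c, d, h, h'⟩ | h)
        · rcases Sym2.eq_iff.1 h' with ⟨rfl, rfl⟩ | ⟨rfl, rfl⟩
          · exact Or.inl h
          · exact Or.inr (Or.inl h)
        · exact Or.inr (Or.inr h)
  have hdisj : Disjoint ((fun e : V × V => s(e.1, e.2)) '' {e | G.dir e.1 e.2})
      G.bidir.edgeSet := by
    rw [Set.disjoint_left]
    rintro _ ⟨⟨a, b⟩, hab, rfl⟩ h
    exact (Into.not_dir (Or.inr (SimpleGraph.Adj.symm h))) hab
  rw [hunion, Set.ncard_union_eq hdisj (Set.toFinite _) (Set.toFinite _),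
    hinj.ncard_image, numEdges]

end DirectedAncestralGraph

/-! ### Independence maps -/

namespace DMAG

variable {V : Type*} [Finite V] {X : V → Type*} [∀ i, MeasurableSpace (X i)]
  [∀ i, StandardBorelSpace (X i)] {P : Measure (∀ i, X i)} [IsProbabilityMeasure P]
  {G H : DMAG V}

lemma IsIMAP.condInd (hG : G.IsIMAP P) {i j : V} (hij : i ≠ j) {S : Set V}
    (hS : S ⊆ {i, j}ᶜ) (h : ¬ G.MConn i j S) : CondInd P {i} {j} S := by
  have hi : i ∉ S := fun h' => hS h' (by simp)
  have hj : j ∉ S := fun h' => hS h' (by simp)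
  have : (({i}, {j}, S) : Set V × Set V × Set V) ∈ G.indep :=
    ⟨by simpa using hij, by simpa using hi, by simpa using hj, by
      rintro _ rfl _ rfl
      exact h⟩
  exact (hG this).2.2.2

lemma AdjacencyFaithful.skel_le (h : AdjacencyFaithful P H) (hG : G.IsIMAP P) :
    H.skel ≤ G.skel := by
  have key : ∀ i j, H.dir i j ∨ H.bidir.Adj i j → G.skel.Adj i j := by
    intro i j hij
    by_contra hadj
    have hne : i ≠ j := (DirectedAncestralGraph.Into.adj hij).ne
    obtain ⟨S, hS, hsep⟩ := G.maximal i j hne hadj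
    exact h i j hij S hS (hG.condInd hne hS (hsep _ rfl _ rfl))
  rintro i j (hij | hij | hij)
  · exact key i j (Or.inl hij)
  · exact (key j i (Or.inl hij)).symm
  · exact key i j (Or.inr hij)

end DMAG

theorem theorem1 {V : Type*} [Finite V] {X : V → Type*} [∀ i, MeasurableSpace (X i)]
    [∀ i, StandardBorelSpace (X i)] (P : Measure (∀ i, X i)) [IsProbabilityMeasure P]
    (Gstar : DMAG V) (hstar : Gstar.IsIMAP P)
    (G : DMAG V) (hG : G.IsIMAP P)
    (hmin : ∀ H : DMAG V, H.IsIMAP P → G.numEdges ≤ H.numEdges) :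
    (DMAG.AdjacencyFaithful P Gstar → G.skel = Gstar.skel) ∧
    (DMAG.RestrictedFaithful P Gstar → G ∈ Gstar.markovClass) := by
  have hskel : DMAG.AdjacencyFaithful P Gstar → G.skel = Gstar.skel := fun h => by
    have hle := h.skel_le hG
    have hcard := hmin Gstar hstar
    rw [DirectedAncestralGraph.numEdges_eq_ncard_edgeSet_skel,
      DirectedAncestralGraph.numEdges_eq_ncard_edgeSet_skel] at hcard
    exact (SimpleGraph.edgeSet_injective (Set.eq_of_subset_of_ncard_le
      (SimpleGraph.edgeSet_subset_edgeSet.2 hle) hcard (Set.toFinite _))).symm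
  refine ⟨hskel, fun ⟨_, hadj, htri, hdisc⟩ => ?_⟩
  refine (DirectedAncestralGraph.sameColliders_of_separation (hskel hadj) G.maximal
    (fun i k j hij hik hkj S hS h h' => htri i k j hij hik hkj S hS h' (hG.condInd hij hS h))
    fun i k j hp S hS h h' => ?_).indep_eq G.maximal Gstar.maximal
  have hij : i ≠ j := by
    rintro rfl
    obtain ⟨p, hp, -, -, hlen, -⟩ := hp
    have := SimpleGraph.Walk.length_eq_zero_iff.2 (SimpleGraph.Walk.isPath_iff_nil.1 hp)
    omega
  exact hdisc i k j hp S hS h' (hG.condInd hij hS h)
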